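/- Let $d \ge 1$ and $N \ge 1$ be integers and let $r > 0$. Write $\lambda$ for Lebesgue measure on $\mathbb{R}^d$, $B(x;\rho)$ for the closed Euclidean ball with centre $x$ and radius $\rho$, $B = B(0;1)$, $\Omega_d = d\,\lambda(B)$ for the surface area of the unit ball, and $S \oplus T = \{s+t : s \in S,\ t \in T\}$ for the Minkowski sum. For a measurable set $S \subseteq \mathbb{R}^d$ of finite volume, the lower and upper surface areas of $S$ are the lower and upper limits, as $\delta \downarrow 0$, of $$\frac{\lambda(S \oplus \delta B) - \lambda(S)}{\delta};$$ if they agree, their common value is the surface area of $S$, denoted $\lambda(\partial S)$. Let $x_0, x_1, \dots, x_N \in \mathbb{R}^d$ with $x_i \in B(x_0; r)$ for $1 \le i \le N$, and let $A = \{x_0, x_1, \dots, x_N\}$. Then the surface area of $A \oplus rB$ exists (the lower and upper surface areas agree), and $$\lambda(\partial (A \oplus rB)) \le 2^{d-1}\, \Omega_d\, r^{d-1}.$$ -/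

import Mathlib

open MeasureTheory Filter Topology
open scoped ENNReal Pointwise

noncomputable section

/-- The closed Euclidean unit ball `B` of `ℝ^d`. -/
def unitBall (d : ℕ) : Set (EuclideanSpace ℝ (Fin d)) :=
  Metric.closedBall 0 1

/-- The difference quotient `(λ(A ⊕ δK) - λ(A)) / δ`. It is meant for `λ(A) < ∞`, `0 ∈ K` and
`δ > 0`; then `A ⊆ A ⊕ δK`, so the subtraction in `[0, ∞]` is the ordinary one. -/
def volumeQuotient {d : ℕ} (K A : Set (EuclideanSpace ℝ (Fin d))) (δ : ℝ) : ℝ≥0∞ :=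
  (volume (A + δ • K) - volume A) / ENNReal.ofReal δ

/-- The lower `K`-surface area (Minkowski) of `A`. -/
def lowerSurfaceArea {d : ℕ} (K A : Set (EuclideanSpace ℝ (Fin d))) : ℝ≥0∞ :=
  liminf (volumeQuotient K A) (𝓝[>] 0)

/-- The upper `K`-surface area (Minkowski) of `A`. -/
def upperSurfaceArea {d : ℕ} (K A : Set (EuclideanSpace ℝ (Fin d))) : ℝ≥0∞ :=
  limsup (volumeQuotient K A) (𝓝[>] 0)

/-- `A` has surface area `s`: the lower and the upper surface area of `A`
with respect to the Euclidean unit ball agree, and `s` is their common value. -/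
def HasSurfaceArea {d : ℕ} (A : Set (EuclideanSpace ℝ (Fin d))) (s : ℝ≥0∞) : Prop :=
  lowerSurfaceArea (unitBall d) A = s ∧ upperSurfaceArea (unitBall d) A = s

/-- The `r`-parallel set `A ⊕ rB` (Minkowski sum). -/
def parallelSet {d : ℕ} (A : Set (EuclideanSpace ℝ (Fin d))) (r : ℝ) :
    Set (EuclideanSpace ℝ (Fin d)) :=
  A + r • unitBall d

/-- `ω_d`, the volume of the unit ball of `ℝ^d`. -/
def unitBallVolume (d : ℕ) : ℝ :=
  volume.real (unitBall d)

/-- `Ω_d = d ω_d`, the surface area of the unit ball of `ℝ^d`. -/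
def unitBallSurfaceArea (d : ℕ) : ℝ :=
  d * unitBallVolume d

end

/-! For t ≥ r every ball B(x_i; t) contains x_0, so the union of these balls is star-shaped about
x_0. In polar coordinates around x_0 its volume is the integral of ρ(u, t)^d / d over the unit
sphere, where ρ is the largest of the distances at which the ray in direction u leaves the balls. As
t ↓ r, the difference quotient of ρ^d / d converges for every u
(`exists_tendsto_unionRadius_pow_slope`) and never exceeds (2t)^(d-1) (`unionRadius_pow_sub_le`,
reduced to one ball by `rayExit_pow_sub_le`). Dominated convergence then yields both the existence
of the surface area and the bound (2r)^(d-1) Ω_d. -/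

section RadialFunction

/-! ### Exit distance of a ray from a single ball -/

variable {E : Type*} [NormedAddCommGroup E] [InnerProductSpace ℝ E]

/-- The distance from the origin at which the ray in the unit direction `u` leaves the ball of
radius `t ≥ ‖a‖` centred at `a`. -/
noncomputable def rayExit (a u : E) (t : ℝ) : ℝ :=
  inner ℝ u a + √(inner ℝ u a ^ 2 + t ^ 2 - ‖a‖ ^ 2)

lemma rayExit_zero (u : E) {t : ℝ} (ht : 0 ≤ t) : rayExit 0 u t = t := by
  simp [rayExit, Real.sqrt_sq ht]

lemma continuous_rayExit (a : E) : Continuous fun p : E × ℝ ↦ rayExit a p.1 p.2 := by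
  unfold rayExit
  fun_prop

lemma inner_sq_add_sq_sub_nonneg {a : E} (u : E) {t : ℝ} (hat : ‖a‖ ≤ t) :
    0 ≤ inner ℝ u a ^ 2 + t ^ 2 - ‖a‖ ^ 2 := by
  nlinarith [sq_nonneg (inner ℝ u a), norm_nonneg a]

lemma abs_inner_le_sqrt {a : E} (u : E) {t : ℝ} (hat : ‖a‖ ≤ t) :
    |inner ℝ u a| ≤ √(inner ℝ u a ^ 2 + t ^ 2 - ‖a‖ ^ 2) := by
  apply Real.abs_le_sqrt
  nlinarith [norm_nonneg a]

lemma rayExit_nonneg {a : E} (u : E) {t : ℝ} (hat : ‖a‖ ≤ t) : 0 ≤ rayExit a u t := by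
  have := abs_inner_le_sqrt u hat
  have := neg_abs_le (inner ℝ u a)
  unfold rayExit
  linarith

lemma two_mul_inner_le_rayExit {a : E} (u : E) {t : ℝ} (hat : ‖a‖ ≤ t) :
    2 * inner ℝ u a ≤ rayExit a u t := by
  have := abs_inner_le_sqrt u hat
  have := le_abs_self (inner ℝ u a)
  unfold rayExit
  linarith

lemma rayExit_sq {a : E} (u : E) {t : ℝ} (hat : ‖a‖ ≤ t) :
    rayExit a u t ^ 2 = 2 * rayExit a u t * inner ℝ u a + t ^ 2 - ‖a‖ ^ 2 := by
  have := Real.sq_sqrt (inner_sq_add_sq_sub_nonneg u hat)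
  unfold rayExit
  linarith

lemma rayExit_le_rayExit (a u : E) {s t : ℝ} (hs : 0 ≤ s) (hst : s ≤ t) :
    rayExit a u s ≤ rayExit a u t := by
  unfold rayExit
  gcongr

lemma rayExit_le_two_mul {a u : E} (hu : ‖u‖ = 1) {t : ℝ} (hat : ‖a‖ ≤ t) :
    rayExit a u t ≤ 2 * t := by
  have h1 : |inner ℝ u a| ≤ ‖a‖ := by simpa [hu] using abs_real_inner_le_norm u a
  have h2 : √(inner ℝ u a ^ 2 + t ^ 2 - ‖a‖ ^ 2) ≤ t := by
    rw [Real.sqrt_le_left ((norm_nonneg a).trans hat)]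
    have := sq_le_sq.2 (h1.trans (le_abs_self _))
    linarith
  have := le_abs_self (inner ℝ u a)
  unfold rayExit
  linarith

lemma smul_mem_ball_iff_lt_rayExit {a u : E} (hu : ‖u‖ = 1) {t : ℝ} (hat : ‖a‖ ≤ t) {s : ℝ}
    (hs : 0 < s) : s • u ∈ Metric.ball a t ↔ s < rayExit a u t := by
  have ht : 0 ≤ t := (norm_nonneg a).trans hat
  have hsq : ‖s • u - a‖ ^ 2 = s ^ 2 - 2 * (s * inner ℝ u a) + ‖a‖ ^ 2 := by
    rw [norm_sub_sq_real, norm_smul, hu, real_inner_smul_left]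
    simp
  have h1 := abs_inner_le_sqrt u hat
  have h2 := neg_abs_le (inner ℝ u a)
  have h3 := le_abs_self (inner ℝ u a)
  rw [mem_ball_iff_norm, ← sq_lt_sq₀ (norm_nonneg _) ht, hsq, rayExit, ← sub_lt_iff_lt_add']
  constructor
  · intro h
    apply Real.lt_sqrt_of_sq_lt
    linarith
  · intro h
    have := sq_lt_sq.2 (lt_of_lt_of_le (abs_lt.2 ⟨by linarith, h⟩) (le_abs_self _))
    rw [Real.sq_sqrt (inner_sq_add_sq_sub_nonneg u hat)] at this
    linarith

/-! ### Growth of powers of the exit distance -/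

lemma pow_succ_sub_pow_succ_le {p q : ℝ} (hp : 0 ≤ p) (hpq : p ≤ q) (n : ℕ) :
    q ^ (n + 1) - p ^ (n + 1) ≤ (n + 1) * q ^ n * (q - p) := by
  induction n with
  | zero => simp
  | succ n ih =>
    have h1 := mul_le_mul_of_nonneg_left ih (hp.trans hpq)
    have h2 := mul_le_mul_of_nonneg_right (pow_le_pow_left₀ hp hpq (n + 1)) (sub_nonneg.2 hpq)
    push_cast
    linear_combination h1 + h2

/-- With c = ⟨u, a⟩, subtracting the quadratic equations for p and q gives (q - p)(q + p - 2c) = t²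
- r². Since p ≥ 2c, it follows that q(q - p) ≤ t² - r² ≤ 2t(t - r). This uses up one factor q, hence
the exponent n + 2; dimension 1 is treated apart. -/
lemma rayExit_pow_sub_le {a u : E} (hu : ‖u‖ = 1) {r t : ℝ} (har : ‖a‖ ≤ r) (hrt : r ≤ t)
    (n : ℕ) :
    rayExit a u t ^ (n + 2) - rayExit a u r ^ (n + 2) ≤
      (n + 2) * (2 * t) ^ (n + 1) * (t - r) := by
  have hr : 0 ≤ r := (norm_nonneg a).trans har
  have hp := rayExit_nonneg u har
  have hpq := rayExit_le_rayExit a u hr hrt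
  have hqt := rayExit_le_two_mul hu (har.trans hrt)
  have hsq := rayExit_sq u har
  have hsq' := rayExit_sq u (har.trans hrt)
  have hc := two_mul_inner_le_rayExit u har
  set p := rayExit a u r
  set q := rayExit a u t
  have hq : 0 ≤ q := hp.trans hpq
  have key : q * (q - p) ≤ (2 * t) * (t - r) := by
    nlinarith [mul_nonneg (sub_nonneg.2 hpq) (sub_nonneg.2 hc), sq_nonneg (t - r)]
  calc q ^ (n + 2) - p ^ (n + 2) ≤ ((n + 1 : ℕ) + 1) * q ^ (n + 1) * (q - p) :=
        pow_succ_sub_pow_succ_le hp hpq (n + 1)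
    _ = (n + 2) * q ^ n * (q * (q - p)) := by push_cast; ring
    _ ≤ (n + 2) * (2 * t) ^ n * ((2 * t) * (t - r)) := by
        have : 0 ≤ 2 * t := hq.trans hqt
        gcongr
    _ = _ := by ring

/-- Here a is a multiple of u, so the radicand is just t². -/
lemma rayExit_sub_eq_of_finrank_eq_one (hE : Module.finrank ℝ E = 1) {a u : E} (hu : ‖u‖ = 1)
    {r t : ℝ} (hr : 0 ≤ r) (hrt : r ≤ t) : rayExit a u t - rayExit a u r = t - r := by
  obtain ⟨k, rfl⟩ := (finrank_eq_one_iff_of_nonzero' u (by rintro rfl; simp at hu)).1 hE a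
  simp [rayExit, real_inner_smul_right, norm_smul, hu, Real.sqrt_sq hr,
    Real.sqrt_sq (hr.trans hrt)]

lemma rayExit_pow_finrank_sub_le {a u : E} (hu : ‖u‖ = 1) {r t : ℝ}
    (har : ‖a‖ ≤ r) (hrt : r ≤ t) {d : ℕ} (hd : 1 ≤ d) (hE : Module.finrank ℝ E = d) :
    rayExit a u t ^ d - rayExit a u r ^ d ≤ d * (2 * t) ^ (d - 1) * (t - r) := by
  obtain rfl | ⟨n, rfl⟩ : d = 1 ∨ ∃ n, d = n + 2 := by
    obtain _ | _ | n := d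
    · omega
    · exact .inl rfl
    · exact .inr ⟨n, rfl⟩
  · simp [rayExit_sub_eq_of_finrank_eq_one hE hu ((norm_nonneg a).trans har) hrt]
  · simpa using rayExit_pow_sub_le hu har hrt n

/-! ### One-sided derivatives of maxima -/

lemma exists_hasDerivWithinAt_sup {f g : ℝ → ℝ} {r : ℝ}
    (hf : ∃ L, HasDerivWithinAt f L (Set.Ioi r) r) (hg : ∃ L, HasDerivWithinAt g L (Set.Ioi r) r) :
    ∃ L, HasDerivWithinAt (f ⊔ g) L (Set.Ioi r) r := by
  obtain ⟨L, hL⟩ := hf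
  obtain ⟨M, hM⟩ := hg
  rcases lt_trichotomy (f r) (g r) with h | h | h
  · refine ⟨M, hM.congr_of_eventuallyEq ?_ (by simp [h.le])⟩
    filter_upwards [hL.continuousWithinAt.eventually_lt hM.continuousWithinAt h] with x hx
    simp [hx.le]
  · refine ⟨L ⊔ M, ?_⟩
    rw [hasDerivWithinAt_iff_tendsto_slope' (by simp)] at *
    refine (hL.max hM).congr' ?_
    filter_upwards [self_mem_nhdsWithin] with x hx
    have hx' : 0 ≤ x - r := sub_nonneg.2 (le_of_lt hx)
    simp only [slope_def_field, Pi.sup_apply, h, sup_idem]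
    rw [max_div_div_right hx', max_sub_sub_right]
  · refine ⟨L, hL.congr_of_eventuallyEq ?_ (by simp [h.le])⟩
    filter_upwards [hM.continuousWithinAt.eventually_lt hL.continuousWithinAt h] with x hx
    simp [hx.le]

/-- The square root can fail to be differentiable only if its radicand vanishes at r, which forces
‖a‖ = r and u ⟂ a. The exit distance is then 0 < r, so the maximum with `id` is `id` near r. -/
lemma exists_hasDerivWithinAt_rayExit_sup_id {a u : E} {r : ℝ} (hr : 0 < r) (har : ‖a‖ ≤ r) :
    ∃ L, HasDerivWithinAt ((fun t ↦ rayExit a u t) ⊔ id) L (Set.Ioi r) r := by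
  rcases lt_or_ge (rayExit a u r) r with h | h
  · refine ⟨1, (hasDerivWithinAt_id r _).congr_of_eventuallyEq ?_ (by simp [h.le])⟩
    have hc : Continuous fun t ↦ rayExit a u t :=
      (continuous_rayExit a).comp (by fun_prop : Continuous fun t : ℝ ↦ (u, t))
    filter_upwards [hc.continuousWithinAt.eventually_lt continuousWithinAt_id h] with x hx
    simpa using hx.le
  · refine exists_hasDerivWithinAt_sup ?_ ⟨1, hasDerivWithinAt_id r _⟩
    have hne : inner ℝ u a ^ 2 + r ^ 2 - ‖a‖ ^ 2 ≠ 0 := by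
      intro h0
      have h1 : inner ℝ u a ^ 2 = 0 := by
        nlinarith [sq_nonneg (inner ℝ u a), norm_nonneg a]
      have h2 : inner ℝ u a = 0 := by simpa using h1
      rw [rayExit, h0, h2] at h
      simp at h
      linarith
    have hd : DifferentiableAt ℝ (fun t ↦ rayExit a u t) r := by
      unfold rayExit
      have : DifferentiableAt ℝ (fun t : ℝ ↦ inner ℝ u a ^ 2 + t ^ 2 - ‖a‖ ^ 2) r := by fun_prop
      exact (this.sqrt hne).const_add _
    exact ⟨_, hd.hasDerivAt.hasDerivWithinAt⟩

/-! ### Radial function of the union -/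

variable {ι : Type*} [Fintype ι] [Nonempty ι]

/-- The radial function, in the unit direction `u`, of the union of the balls of radius `t` centred
at the points `a i`. -/
noncomputable def unionRadius (a : ι → E) (u : E) (t : ℝ) : ℝ :=
  Finset.univ.sup' Finset.univ_nonempty fun i ↦ rayExit (a i) u t

lemma rayExit_le_unionRadius (a : ι → E) (u : E) (t : ℝ) (i : ι) :
    rayExit (a i) u t ≤ unionRadius a u t :=
  Finset.le_sup' (fun i ↦ rayExit (a i) u t) (Finset.mem_univ i)

lemma exists_unionRadius_eq (a : ι → E) (u : E) (t : ℝ) :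
    ∃ i, unionRadius a u t = rayExit (a i) u t := by
  obtain ⟨i, -, hi⟩ := Finset.exists_mem_eq_sup' Finset.univ_nonempty fun i ↦ rayExit (a i) u t
  exact ⟨i, hi⟩

lemma continuous_unionRadius (a : ι → E) (t : ℝ) : Continuous fun u ↦ unionRadius a u t := by
  refine Continuous.finset_sup'_apply _ fun i _ ↦ ?_
  exact (continuous_rayExit (a i)).comp (by fun_prop : Continuous fun u : E ↦ (u, t))

lemma le_unionRadius {a : ι → E} (u : E) {t : ℝ} (ht : 0 ≤ t) {i₀ : ι} (h₀ : a i₀ = 0) :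
    t ≤ unionRadius a u t := by
  simpa [h₀, rayExit_zero u ht] using rayExit_le_unionRadius a u t i₀

lemma unionRadius_le_unionRadius (a : ι → E) (u : E) {s t : ℝ} (hs : 0 ≤ s) (hst : s ≤ t) :
    unionRadius a u s ≤ unionRadius a u t :=
  Finset.sup'_mono_fun fun i _ ↦ rayExit_le_rayExit (a i) u hs hst

lemma unionRadius_pow_sub_le {a : ι → E} {u : E} (hu : ‖u‖ = 1) {r t : ℝ}
    (har : ∀ i, ‖a i‖ ≤ r) (hrt : r ≤ t) {d : ℕ} (hd : 1 ≤ d) (hE : Module.finrank ℝ E = d) :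
    unionRadius a u t ^ d - unionRadius a u r ^ d ≤ d * (2 * t) ^ (d - 1) * (t - r) := by
  obtain ⟨i, hi⟩ := exists_unionRadius_eq a u t
  have h1 := rayExit_pow_finrank_sub_le hu (har i) hrt hd hE
  have h2 := pow_le_pow_left₀ (rayExit_nonneg u (har i)) (rayExit_le_unionRadius a u r i) d
  rw [hi]
  linarith

/-- The centre 0 contributes the exit distance t itself, so taking the maximum of each term with
`id` changes nothing for t ≥ 0 and removes the singular square roots. -/
lemma exists_hasDerivWithinAt_unionRadius {a : ι → E} {u : E} {r : ℝ} (hr : 0 < r)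
    (har : ∀ i, ‖a i‖ ≤ r) {i₀ : ι} (h₀ : a i₀ = 0) :
    ∃ L, HasDerivWithinAt (unionRadius a u) L (Set.Ioi r) r := by
  obtain ⟨L, hL⟩ : ∃ L, HasDerivWithinAt (Finset.univ.sup' Finset.univ_nonempty
      fun i ↦ (fun t ↦ rayExit (a i) u t) ⊔ id) L (Set.Ioi r) r :=
    Finset.sup'_induction (p := fun f : ℝ → ℝ ↦ ∃ L, HasDerivWithinAt f L (Set.Ioi r) r) _ _
      (fun _ hf _ hg ↦ exists_hasDerivWithinAt_sup hf hg)
      fun i _ ↦ exists_hasDerivWithinAt_rayExit_sup_id hr (har i)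
  have heq : ∀ t, 0 ≤ t → unionRadius a u t = (Finset.univ.sup' Finset.univ_nonempty
      fun i ↦ (fun t ↦ rayExit (a i) u t) ⊔ id) t := by
    intro t ht
    rw [Finset.sup'_apply]
    refine le_antisymm (Finset.sup'_mono_fun fun i _ ↦ le_sup_left) (Finset.sup'_le _ _ ?_)
    exact fun i _ ↦ sup_le (rayExit_le_unionRadius a u t i) (le_unionRadius u ht h₀)
  refine ⟨L, hL.congr_of_eventuallyEq ?_ (heq r hr.le)⟩
  filter_upwards [self_mem_nhdsWithin] with t ht
  exact heq t (hr.le.trans (le_of_lt ht))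

lemma exists_tendsto_unionRadius_pow_slope {a : ι → E} {u : E} {r : ℝ} (hr : 0 < r)
    (har : ∀ i, ‖a i‖ ≤ r) {i₀ : ι} (h₀ : a i₀ = 0) (d : ℕ) :
    ∃ L, Tendsto (fun δ ↦ (unionRadius a u (r + δ) ^ d - unionRadius a u r ^ d) / d / δ)
      (𝓝[>] 0) (𝓝 L) := by
  obtain ⟨L, hL⟩ := exists_hasDerivWithinAt_unionRadius (u := u) hr har h₀
  have h := (hL.pow d).div_const (d : ℝ)
  rw [hasDerivWithinAt_iff_tendsto_slope' (by simp)] at h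
  have hmap : Tendsto (fun δ : ℝ ↦ r + δ) (𝓝[>] 0) (𝓝[>] r) := by
    refine tendsto_nhdsWithin_iff.2 ⟨?_, ?_⟩
    · have : Tendsto (fun δ : ℝ ↦ r + δ) (𝓝 0) (𝓝 (r + 0)) :=
        (continuous_const.add continuous_id).tendsto 0
      rw [add_zero] at this
      exact this.mono_left nhdsWithin_le_nhds
    · filter_upwards [self_mem_nhdsWithin] with δ hδ
      simpa using hδ
  refine ⟨_, (h.comp hmap).congr fun δ ↦ ?_⟩
  simp [slope_def_field, sub_div]

end RadialFunction

/-! ### Volume in polar coordinates and passage to the limit -/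

section Volume

variable {E : Type*} [NormedAddCommGroup E] [InnerProductSpace ℝ E] [FiniteDimensional ℝ E]
  [MeasurableSpace E] {ι : Type*} [Fintype ι]

lemma measure_iUnion_closedBall_ne_top (μ : Measure E) [μ.IsAddHaarMeasure] (x : ι → E) (t : ℝ) :
    μ (⋃ i, Metric.closedBall (x i) t) ≠ ∞ :=
  (isCompact_iUnion fun i ↦ isCompact_closedBall (x i) t).measure_ne_top

variable [BorelSpace E]

lemma measure_iUnion_closedBall_eq_iUnion_ball (μ : Measure E) [μ.IsAddHaarMeasure] (a : ι → E)
    {t : ℝ} (ht : t ≠ 0) :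
    μ (⋃ i, Metric.closedBall (a i) t) = μ (⋃ i, Metric.ball (a i) t) := by
  refine measure_congr (Filter.EventuallyEq.countable_iUnion fun i ↦ ?_)
  rw [← Metric.ball_union_sphere]
  exact union_ae_eq_left_of_ae_eq_empty
    (ae_eq_empty.2 (Measure.addHaar_sphere_of_ne_zero μ (a i) ht))

variable [Nonempty ι]

lemma measure_iUnion_ball_eq_lintegral [Nontrivial E] (μ : Measure E) [μ.IsAddHaarMeasure]
    {a : ι → E} {t : ℝ} (ht : 0 < t) (hat : ∀ i, ‖a i‖ ≤ t) {i₀ : ι} (h₀ : a i₀ = 0) :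
    μ (⋃ i, Metric.ball (a i) t) = ∫⁻ u : Metric.sphere (0 : E) 1,
      ENNReal.ofReal (unionRadius a u t ^ Module.finrank ℝ E / Module.finrank ℝ E)
        ∂μ.toSphere := by
  set U : Set E := ⋃ i, Metric.ball (a i) t
  have hU : MeasurableSet U := (isOpen_iUnion fun i ↦ Metric.isOpen_ball).measurableSet
  set e := homeomorphUnitSphereProd E
  have hpos : ∀ u : Metric.sphere (0 : E) 1, 0 < unionRadius a (u : E) t := fun u ↦
    ht.trans_le (le_unionRadius _ ht.le h₀)
  set W : Set (Metric.sphere (0 : E) 1 × Set.Ioi (0 : ℝ)) :=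
    {p | (p.2 : ℝ) < unionRadius a (p.1 : E) t}
  have hW : MeasurableSet W := by
    refine measurableSet_lt (by fun_prop) ?_
    exact ((continuous_unionRadius a t).comp
      (continuous_subtype_val.comp continuous_fst)).measurable
  have hpre : ((↑) : ({0}ᶜ : Set E) → E) ⁻¹' U = e ⁻¹' W := by
    ext y
    have hy : (y : E) ≠ 0 := y.2
    have hy' : 0 < ‖(y : E)‖ := norm_pos_iff.2 hy
    have hn : ‖‖(y : E)‖⁻¹ • (y : E)‖ = 1 := by simp [norm_smul, hy]
    have hs : (y : E) = ‖(y : E)‖ • ‖(y : E)‖⁻¹ • (y : E) := by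
      rw [smul_smul, mul_inv_cancel₀ hy'.ne', one_smul]
    have hball : ∀ i, (y : E) ∈ Metric.ball (a i) t ↔
        ‖(y : E)‖ < rayExit (a i) (‖(y : E)‖⁻¹ • (y : E)) t := fun i ↦ by
      rw [← smul_mem_ball_iff_lt_rayExit hn (hat i) hy', ← hs]
    simp only [Set.mem_preimage, U, Set.mem_iUnion, hball, W, Set.mem_ofPred_eq, e,
      homeomorphUnitSphereProd_apply_snd_coe, homeomorphUnitSphereProd_apply_fst_coe, unionRadius,
      Finset.lt_sup'_iff, Finset.mem_univ, true_and]
  calc μ U = μ.comap ((↑) : ({0}ᶜ : Set E) → E) (((↑) : ({0}ᶜ : Set E) → E) ⁻¹' U) := by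
        rw [comap_subtype_coe_apply (measurableSet_singleton _).compl,
          Subtype.image_preimage_coe, Set.inter_comm, ← Set.sdiff_eq,
          measure_sdiff_null (measure_singleton _)]
    _ = (μ.toSphere.prod (Measure.volumeIoiPow (Module.finrank ℝ E - 1))) W := by
        rw [hpre, μ.measurePreserving_homeomorphUnitSphereProd.measure_preimage
          hW.nullMeasurableSet]
    _ = _ := by
        rw [Measure.prod_apply hW]
        refine lintegral_congr fun u ↦ ?_
        -- The radial measure has density s^(d-1), so the slice below ρ has mass ρ^d / d.
        have := Measure.volumeIoiPow_apply_Iio (Module.finrank ℝ E - 1)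
          ⟨unionRadius a (u : E) t, hpos u⟩
        have hd : 1 ≤ Module.finrank ℝ E := Module.finrank_pos
        rw [Nat.sub_add_cancel hd, Nat.cast_sub hd, Nat.cast_one, sub_add_cancel] at this
        exact this

lemma measure_iUnion_closedBall_eq_lintegral [Nontrivial E] (μ : Measure E) [μ.IsAddHaarMeasure]
    {x : ι → E} {i₀ : ι} {t : ℝ} (ht : 0 < t) (hxt : ∀ i, ‖x i - x i₀‖ ≤ t) :
    μ (⋃ i, Metric.closedBall (x i) t) = ∫⁻ u : Metric.sphere (0 : E) 1,
      ENNReal.ofReal (unionRadius (fun i ↦ x i - x i₀) u t ^ Module.finrank ℝ E /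
        Module.finrank ℝ E) ∂μ.toSphere := by
  rw [← measure_iUnion_ball_eq_lintegral μ ht hxt (sub_self (x i₀)),
    ← measure_iUnion_closedBall_eq_iUnion_ball μ _ ht.ne',
    ← measure_preimage_add μ (x i₀) (⋃ i, Metric.closedBall (x i) t)]
  congr 1
  ext y
  simp only [Set.mem_preimage, Set.mem_iUnion, mem_closedBall_iff_norm]
  refine exists_congr fun i ↦ ?_
  rw [show x i₀ + y - x i = y - (x i - x i₀) by abel]

lemma measure_iUnion_closedBall_sub_div_eq_lintegral [Nontrivial E] (μ : Measure E)
    [μ.IsAddHaarMeasure] {x : ι → E} {i₀ : ι} {r δ : ℝ} (hr : 0 < r)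
    (hxr : ∀ i, ‖x i - x i₀‖ ≤ r) (hδ : 0 < δ) :
    (μ (⋃ i, Metric.closedBall (x i) (r + δ)) - μ (⋃ i, Metric.closedBall (x i) r)) /
      ENNReal.ofReal δ = ∫⁻ u : Metric.sphere (0 : E) 1,
        ENNReal.ofReal ((unionRadius (fun i ↦ x i - x i₀) u (r + δ) ^ Module.finrank ℝ E -
          unionRadius (fun i ↦ x i - x i₀) u r ^ Module.finrank ℝ E) / Module.finrank ℝ E / δ)
        ∂μ.toSphere := by
  have hfin := measure_iUnion_closedBall_ne_top μ x r
  have hmeas : ∀ t, Measurable fun u : Metric.sphere (0 : E) 1 ↦ ENNReal.ofReal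
      (unionRadius (fun i ↦ x i - x i₀) (u : E) t ^ Module.finrank ℝ E /
        Module.finrank ℝ E) := fun t ↦ by
    have := ((continuous_unionRadius (fun i ↦ x i - x i₀) t).comp
      (continuous_subtype_val (p := (· ∈ Metric.sphere (0 : E) 1)))).measurable
    exact ((this.pow_const _).div_const _).ennreal_ofReal
  have hnn : ∀ u : E, 0 ≤ unionRadius (fun i ↦ x i - x i₀) u r := fun u ↦
    hr.le.trans (le_unionRadius (i₀ := i₀) u hr.le (sub_self _))
  -- Rewriting `hfin` as well supplies the finite integral that `lintegral_sub` needs.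
  rw [measure_iUnion_closedBall_eq_lintegral μ hr hxr] at *
  rw [measure_iUnion_closedBall_eq_lintegral μ (i₀ := i₀) (add_pos hr hδ)
      fun i ↦ (hxr i).trans (by linarith),
    ← lintegral_sub (hmeas r) hfin, div_eq_mul_inv,
    ← lintegral_mul_const' _ _ (by simpa using hδ)]
  · refine lintegral_congr fun u ↦ ?_
    have := hnn u
    rw [← ENNReal.ofReal_sub _ (by positivity), ← div_eq_mul_inv, ← ENNReal.ofReal_div_of_pos hδ,
      sub_div, sub_div, sub_div]
  · refine Filter.Eventually.of_forall fun u ↦ ENNReal.ofReal_le_ofReal ?_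
    have := hnn u
    have := unionRadius_le_unionRadius (fun i ↦ x i - x i₀) (u : E) hr.le
      (by linarith : r ≤ r + δ)
    gcongr

lemma exists_tendsto_measure_iUnion_closedBall_sub_div [Nontrivial E] (μ : Measure E)
    [μ.IsAddHaarMeasure] {x : ι → E} {i₀ : ι} {r : ℝ} (hr : 0 < r)
    (hxr : ∀ i, ‖x i - x i₀‖ ≤ r) :
    ∃ s : ℝ≥0∞, Tendsto (fun δ ↦ (μ (⋃ i, Metric.closedBall (x i) (r + δ)) -
        μ (⋃ i, Metric.closedBall (x i) r)) / ENNReal.ofReal δ) (𝓝[>] 0) (𝓝 s) ∧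
      s ≤ ENNReal.ofReal ((2 * r) ^ (Module.finrank ℝ E - 1)) * μ.toSphere Set.univ := by
  set d := Module.finrank ℝ E
  have hd : 1 ≤ d := Module.finrank_pos
  set a : ι → E := fun i ↦ x i - x i₀
  have h₀ : a i₀ = 0 := sub_self _
  choose L hL using fun u : E ↦ exists_tendsto_unionRadius_pow_slope (u := u) hr hxr h₀ d
  have hbound : ∀ (u : Metric.sphere (0 : E) 1) (δ : ℝ), 0 < δ →
      (unionRadius a (u : E) (r + δ) ^ d - unionRadius a (u : E) r ^ d) / d / δ ≤
        (2 * (r + δ)) ^ (d - 1) := fun u δ hδ ↦ by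
    have := unionRadius_pow_sub_le (norm_eq_of_mem_sphere u) hxr (by linarith : r ≤ r + δ) hd rfl
    have hd' : (0 : ℝ) < d := by exact_mod_cast hd
    rw [div_le_iff₀ hδ, div_le_iff₀ hd']
    linear_combination this
  have hLle : ∀ u : Metric.sphere (0 : E) 1, L u ≤ (2 * r) ^ (d - 1) := fun u ↦ by
    have hc : Tendsto (fun δ : ℝ ↦ (2 * (r + δ)) ^ (d - 1)) (𝓝[>] 0)
        (𝓝 ((2 * (r + 0)) ^ (d - 1))) :=
      (Continuous.tendsto (by fun_prop) 0).mono_left nhdsWithin_le_nhds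
    rw [add_zero] at hc
    refine le_of_tendsto_of_tendsto (hL u) hc ?_
    filter_upwards [self_mem_nhdsWithin] with δ hδ using hbound u δ hδ
  refine ⟨∫⁻ u : Metric.sphere (0 : E) 1, ENNReal.ofReal (L u) ∂μ.toSphere, ?_, ?_⟩
  · have hlim := tendsto_lintegral_filter_of_dominated_convergence
      (μ := μ.toSphere) (l := 𝓝[>] (0 : ℝ))
      (F := fun δ (u : Metric.sphere (0 : E) 1) ↦ ENNReal.ofReal
        ((unionRadius a (u : E) (r + δ) ^ d - unionRadius a (u : E) r ^ d) / d / δ))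
      (f := fun u ↦ ENNReal.ofReal (L u)) (fun _ ↦ ENNReal.ofReal ((2 * (r + 1)) ^ (d - 1)))
      ?_ ?_ ?_ ?_
    · refine hlim.congr' ?_
      filter_upwards [self_mem_nhdsWithin] with δ hδ
      exact (measure_iUnion_closedBall_sub_div_eq_lintegral μ hr hxr hδ).symm
    · refine Filter.Eventually.of_forall fun δ ↦ ?_
      have h : ∀ t, Measurable fun u : Metric.sphere (0 : E) 1 ↦ unionRadius a (u : E) t :=
        fun t ↦ ((continuous_unionRadius a t).comp continuous_subtype_val).measurable
      exact (((((h _).pow_const _).sub ((h _).pow_const _)).div_const _).div_const _).ennreal_ofReal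
    -- Restricting to δ < 1 makes the dominating function constant, hence integrable on the sphere.
    · filter_upwards [Ioo_mem_nhdsGT (zero_lt_one' ℝ)] with δ hδ
      refine Filter.Eventually.of_forall fun u ↦ ENNReal.ofReal_le_ofReal ?_
      refine (hbound u δ hδ.1).trans ?_
      have h1 := hδ.1.le
      have h2 := hδ.2.le
      gcongr
    · simpa using ENNReal.mul_ne_top ENNReal.ofReal_ne_top (measure_ne_top μ.toSphere Set.univ)
    · exact Filter.Eventually.of_forall fun u ↦
        (ENNReal.continuous_ofReal.tendsto _).comp (hL u)
  · rw [← lintegral_const]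
    exact lintegral_mono fun u ↦ ENNReal.ofReal_le_ofReal (hLle u)

end Volume

/-! ### Minkowski sums as unions of balls, and the theorem -/

lemma range_add_closedBall {E ι : Type*} [NormedAddCommGroup E] (x : ι → E) (t : ℝ) :
    Set.range x + Metric.closedBall (0 : E) t = ⋃ i, Metric.closedBall (x i) t := by
  ext y
  simp only [Set.mem_add, Set.mem_range, Set.mem_iUnion, mem_closedBall_iff_norm, sub_zero]
  constructor
  · rintro ⟨_, ⟨i, rfl⟩, z, hz, rfl⟩
    exact ⟨i, by simpa using hz⟩
  · rintro ⟨i, hi⟩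
    exact ⟨_, ⟨i, rfl⟩, y - x i, hi, by abel⟩

lemma smul_unitBall_of_nonneg {d : ℕ} {t : ℝ} (ht : 0 ≤ t) :
    t • unitBall d = Metric.closedBall 0 t :=
  smul_unitClosedBall_of_nonneg ht

lemma parallelSet_range_eq_iUnion {d : ℕ} {ι : Type*} (x : ι → EuclideanSpace ℝ (Fin d)) {t : ℝ}
    (ht : 0 ≤ t) : parallelSet (Set.range x) t = ⋃ i, Metric.closedBall (x i) t := by
  rw [parallelSet, smul_unitBall_of_nonneg ht, range_add_closedBall]

lemma parallelSet_range_add_smul_unitBall {d : ℕ} {ι : Type*}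
    (x : ι → EuclideanSpace ℝ (Fin d)) {r δ : ℝ} (hr : 0 ≤ r) (hδ : 0 ≤ δ) :
    parallelSet (Set.range x) r + δ • unitBall d = ⋃ i, Metric.closedBall (x i) (r + δ) := by
  rw [parallelSet, smul_unitBall_of_nonneg hr, smul_unitBall_of_nonneg hδ, add_assoc,
    closedBall_add_closedBall hr hδ, add_zero, range_add_closedBall]

lemma toSphere_univ_eq_ofReal_unitBallSurfaceArea {d : ℕ} :
    (volume : Measure (EuclideanSpace ℝ (Fin d))).toSphere Set.univ =
      ENNReal.ofReal (unitBallSurfaceArea d) := by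
  rw [Measure.toSphere_apply_univ, unitBallSurfaceArea, unitBallVolume, unitBall,
    ENNReal.ofReal_mul (Nat.cast_nonneg d), ENNReal.ofReal_natCast, ofReal_measureReal
    measure_closedBall_lt_top.ne, Measure.addHaar_unitClosedBall_eq_addHaar_unitBall,
    finrank_euclideanSpace_fin]

/-- If `x_1, …, x_N` lie in the closed ball `B(x_0; r)` and `A = {x_0, …, x_N}`, then the surface
area of `A ⊕ rB` exists and is at most `2^(d-1) Ω_d r^(d-1)`. -/
theorem mainTheorem3 (d : ℕ) (hd : 1 ≤ d) (r : ℝ) (hr : 0 < r) (N : ℕ) (hN : 1 ≤ N)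
    (x : Fin (N + 1) → EuclideanSpace ℝ (Fin d))
    (hx : ∀ i : Fin N, x i.succ ∈ Metric.closedBall (x 0) r) :
    ∃ s : ℝ≥0∞, HasSurfaceArea (parallelSet (Set.range x) r) s ∧
      s ≤ ENNReal.ofReal (2 ^ (d - 1) * unitBallSurfaceArea d * r ^ (d - 1)) := by
  -- This makes the space nontrivial, as polar coordinates require.
  have : Nonempty (Fin d) := ⟨⟨0, hd⟩⟩
  have hxr : ∀ i, ‖x i - x 0‖ ≤ r :=
    Fin.cases (by simpa using hr.le) fun i ↦ mem_closedBall_iff_norm.1 (hx i)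
  obtain ⟨s, hs, hle⟩ := exists_tendsto_measure_iUnion_closedBall_sub_div volume hr hxr
  have hq : Tendsto (volumeQuotient (unitBall d) (parallelSet (Set.range x) r)) (𝓝[>] 0) (𝓝 s) := by
    refine hs.congr' ?_
    filter_upwards [self_mem_nhdsWithin] with δ hδ
    rw [volumeQuotient, parallelSet_range_add_smul_unitBall x hr.le (le_of_lt hδ),
      parallelSet_range_eq_iUnion x hr.le]
  refine ⟨s, ⟨hq.liminf_eq, hq.limsup_eq⟩, hle.trans_eq ?_⟩
  rw [toSphere_univ_eq_ofReal_unitBallSurfaceArea, finrank_euclideanSpace_fin,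
    ← ENNReal.ofReal_mul (by positivity), mul_pow]
  congr 1
  ring
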